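/- Let $n\ge 1$ and $d\ge 2$ be integers and let $k=(k_1,\dots,k_{n+1})$ be integers with $1\le k_i\le d-1$ and $\gcd(k_i,d)=1$ for all $i$. Let $B_{n+1}=\langle s_1,\dots,s_n\rangle$ be the braid group on $n+1$ strands and $P_{n+1}=\ker(B_{n+1}\to S_{n+1})$ the pure braid group. It acts on the free group $F_{n+1}$ on $x_1,\dots,x_{n+1}$ by Artin's formulae $s_i(x_i)=x_ix_{i+1}x_i^{-1}$, $s_i(x_{i+1})=x_i$, $s_i(x_j)=x_j$ for $j\ne i,i+1$. Let $K_0(k,d)$ be the kernel of the homomorphism $F_{n+1}\to\mathbb Z/d\mathbb Z$, $x_i\mapsto k_i$; let $r=\gcd(k_1+\dots+k_{n+1},d)$, let $N$ be the smallest normal subgroup of $F_{n+1}$ containing $x_1^d,\dots,x_{n+1}^d$ and $(x_1x_2\cdots x_{n+1})^{d/r}$, and let $Q_0(k,d)=K_0(k,d)/N$. The action of $P_{n+1}$ on $F_{n+1}$ preserves $K_0(k,d)$ and $N$, so that $P_{n+1}$ acts on $X_0=H_1(Q_0(k,d),\mathbb Q)=Q_0(k,d)^{ab}\otimes\mathbb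 Q$. For a divisor $e\ge 2$ of $d$, put $\omega_e=\exp(2\pi i/e)$, $E_e=\mathbb Q(\omega_e)$ and $t_i=\omega_e^{k_i}$ (so $t_i\neq 1$). Let $x\mapsto(D(x),\chi(x))$ be the homomorphism $F_{n+1}\to E_e^{n+1}\rtimes E_e^*$ with $x_i\mapsto (e_i,t_i)$, where $e_1,\dots,e_{n+1}$ is the standard basis. The Gassner representation of $P_{n+1}$ on $E_e^{n+1}$ at $(t_1,\dots,t_{n+1})$ is given by $b(e_i)=D(b(x_i))$. The reduced Gassner representation $g_n(k,e)$ is its $n$-dimensional subrepresentation spanned by $\varepsilon_i=v_i-v_{i+1}$ $(1\le i\le n)$, where $v_i=e_i/(1-t_i)$. Let $\overline{g_n(k,e)}$ be the quotient of $g_n(k,e)$ by its subspace of $P_{n+1}$-invariant vectors. Then there is an isomorphism of $\mathbb Q$-linear representations of $P_{n+1}$ \[ H_1(Q_0(k,d),\mathbb Q)\;\simeq\;\bigoplus_{e\mid d,\ e\ge 2}\overline{g_n(k,e)}, \] where each $\overline{g_n(k,e)}$ is regarded as a representation over $\mathbb Q$. Moreover, for each divisor $e\ge2$ of $d$, the space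 of invariants of $g_n(k,e)$ has dimension $1$ over $E_e$ if $e$ divides $k_1+\dots+k_{n+1}$, and is zero otherwise. -/

import Mathlib

open scoped TensorProduct DirectSum

noncomputable section

/-! ### Braid groups and the action of the braid group on the free group -/

/-- The relations of the braid group on `n + 1` strands, with generators `s_i`, `i : Fin n`. -/
def braidRels (n : ℕ) : Set (FreeGroup (Fin n)) :=
  {r | ∃ i j : Fin n,
    (i.val + 2 ≤ j.val ∧
      r = (.of i * .of j) * (.of j * .of i)⁻¹) ∨
    (i.val + 1 = j.val ∧
      r = (.of i * .of j * .of i) * (.of j * .of i * .of j)⁻¹)}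

/-- The braid group `B_{n+1}`. -/
abbrev BraidGroup (n : ℕ) : Type := PresentedGroup (braidRels n)

theorem lift_braidRels {n : ℕ} {G : Type*} [Group G] (f : Fin n → G)
    (hcomm : ∀ i j : Fin n, i.val + 2 ≤ j.val → f i * f j = f j * f i)
    (hbraid : ∀ i j : Fin n, i.val + 1 = j.val → f i * f j * f i = f j * f i * f j) :
    ∀ r ∈ braidRels n, FreeGroup.lift f r = 1 := by
  rintro r ⟨i, j, ⟨h, rfl⟩ | ⟨h, rfl⟩⟩
  · simp only [map_mul, map_inv, FreeGroup.lift_apply_of]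
    rw [hcomm i j h, mul_inv_cancel]
  · simp only [map_mul, map_inv, FreeGroup.lift_apply_of]
    rw [hbraid i j h, mul_inv_cancel]

/-- The homomorphism `B_{n+1} → S_{n+1}`, `s_i ↦ (i, i+1)`. -/
def braidPerm (n : ℕ) : BraidGroup n →* Equiv.Perm (Fin (n + 1)) :=
  PresentedGroup.toGroup (f := fun i : Fin n => Equiv.swap i.castSucc i.succ) <| by
    apply lift_braidRels
    · intro i j h
      have e1 : i.castSucc ≠ j.castSucc := by simp [Fin.ext_iff]; omega
      have e2 : i.castSucc ≠ j.succ := by simp [Fin.ext_iff]; omega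
      have e3 : i.succ ≠ j.castSucc := by simp [Fin.ext_iff]; omega
      have e4 : i.succ ≠ j.succ := by simp [Fin.ext_iff]; omega
      rw [Equiv.mul_swap_eq_swap_mul, Equiv.swap_apply_of_ne_of_ne e1.symm e3.symm,
        Equiv.swap_apply_of_ne_of_ne e2.symm e4.symm]
    · intro i j h
      have e0 : j.castSucc = i.succ := by simp [Fin.ext_iff]; omega
      have e2 : i.castSucc ≠ j.succ := by simp [Fin.ext_iff]; omega
      have e4 : i.succ ≠ j.succ := by simp [Fin.ext_iff]; omega
      have e5 : i.castSucc ≠ i.succ := by simp [Fin.ext_iff]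
      rw [e0, Equiv.swap_mul_swap_mul_swap e5 e2, Equiv.swap_comm i.castSucc i.succ,
        Equiv.swap_comm i.succ j.succ, Equiv.swap_mul_swap_mul_swap e4.symm e2.symm,
        Equiv.swap_comm]

/-- The pure braid group `P_{n+1}`. -/
abbrev PureBraidGroup (n : ℕ) : Subgroup (BraidGroup n) := (braidPerm n).ker

/-- The values on the generators of the automorphism `s_i` of the free group:
`x_i ↦ x_i x_{i+1} x_i⁻¹`, `x_{i+1} ↦ x_i`, `x_j ↦ x_j` for the other `j`. -/
def artinFun {n : ℕ} (i : Fin n) (j : Fin (n + 1)) : FreeGroup (Fin (n + 1)) :=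
  if j = i.castSucc then .of i.castSucc * .of i.succ * (.of i.castSucc)⁻¹
  else if j = i.succ then .of i.castSucc
  else .of j

/-- The values on the generators of the inverse of `s_i`. -/
def artinInvFun {n : ℕ} (i : Fin n) (j : Fin (n + 1)) : FreeGroup (Fin (n + 1)) :=
  if j = i.castSucc then .of i.succ
  else if j = i.succ then (.of i.succ)⁻¹ * .of i.castSucc * .of i.succ
  else .of j

theorem succ_ne_castSucc' {n : ℕ} (i : Fin n) : i.succ ≠ i.castSucc := by
  simp [Fin.ext_iff]

/-- The automorphism of the free group given by the generator `s_i`. -/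
def artinGen {n : ℕ} (i : Fin n) : MulAut (FreeGroup (Fin (n + 1))) :=
  MonoidHom.toMulEquiv (FreeGroup.lift (artinFun i)) (FreeGroup.lift (artinInvFun i))
    (by
      ext j
      have := succ_ne_castSucc' i
      by_cases h1 : j = i.castSucc
      · subst h1; simp [artinFun, artinInvFun, this, mul_assoc]
      · by_cases h2 : j = i.succ
        · subst h2; simp [artinFun, artinInvFun, this]
        · simp [artinFun, artinInvFun, h1, h2])
    (by
      ext j
      have := succ_ne_castSucc' i
      by_cases h1 : j = i.castSucc
      · subst h1; simp [artinFun, artinInvFun, this]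
      · by_cases h2 : j = i.succ
        · subst h2; simp [artinFun, artinInvFun, this, mul_assoc]
        · simp [artinFun, artinInvFun, h1, h2])

theorem artinGen_of {n : ℕ} (i : Fin n) (j : Fin (n + 1)) :
    artinGen i (.of j) = artinFun i j := by
  simp [artinGen]

theorem mulAut_free_ext {α : Type*} {f g : MulAut (FreeGroup α)}
    (h : ∀ a, f (.of a) = g (.of a)) : f = g := by
  apply MulEquiv.toMonoidHom_injective
  ext a
  exact h a

/-- Artin's action of the braid group `B_{n+1}` on the free group `F_{n+1}`. -/
def artin (n : ℕ) : BraidGroup n →* MulAut (FreeGroup (Fin (n + 1))) :=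
  PresentedGroup.toGroup (f := fun i : Fin n => artinGen i) <| by
    apply lift_braidRels
    · intro i j h
      apply mulAut_free_ext
      intro a
      have e1 : i.castSucc ≠ j.castSucc := by simp [Fin.ext_iff]; omega
      have e2 : i.castSucc ≠ j.succ := by simp [Fin.ext_iff]; omega
      have e3 : i.succ ≠ j.castSucc := by simp [Fin.ext_iff]; omega
      have e4 : i.succ ≠ j.succ := by simp [Fin.ext_iff]; omega
      have e5 := succ_ne_castSucc' i
      have e6 := succ_ne_castSucc' j
      simp only [MulAut.mul_apply, artinGen_of, artinFun]
      split_ifs <;> simp_all [artinGen_of, artinFun, e1.symm, e2.symm, e3.symm, e4.symm]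
    · intro i j h
      apply mulAut_free_ext
      intro a
      have e0 : j.castSucc = i.succ := by simp [Fin.ext_iff]; omega
      have e2 : i.castSucc ≠ j.succ := by simp [Fin.ext_iff]; omega
      have e4 : i.succ ≠ j.succ := by simp [Fin.ext_iff]; omega
      have e5 := succ_ne_castSucc' i
      simp only [MulAut.mul_apply, artinGen_of, artinFun, e0]
      by_cases h1 : a = i.castSucc
      · subst h1
        simp [artinGen_of, artinFun, e0, e2, e2.symm, e4.symm, e5, e5.symm, mul_assoc]
      · by_cases h2 : a = i.succ
        · subst h2
          simp [artinGen_of, artinFun, e0, e2, e2.symm, e4.symm, e5, e5.symm, mul_assoc]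
        · by_cases h3 : a = j.succ
          · subst h3
            simp [artinGen_of, artinFun, e0, e2, e2.symm, e4.symm, e5, e5.symm]
          · simp [artinGen_of, artinFun, e0, h1, h2, h3]

theorem artin_of {n : ℕ} (i : Fin n) : artin n (PresentedGroup.of i) = artinGen i := by
  simp [artin]

theorem braidPerm_of {n : ℕ} (i : Fin n) :
    braidPerm n (PresentedGroup.of i) = Equiv.swap i.castSucc i.succ := by
  simp [braidPerm]

/-- Induction on braids. -/
theorem braid_induction {n : ℕ} {p : BraidGroup n → Prop} (h1 : p 1)
    (hg : ∀ i, p (PresentedGroup.of i)) (hm : ∀ a b, p a → p b → p (a * b))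
    (hi : ∀ a, p a → p a⁻¹) (b : BraidGroup n) : p b := by
  have hb : b ∈ Subgroup.closure (Set.range (PresentedGroup.of (rels := braidRels n))) := by
    rw [PresentedGroup.closure_range_of]; trivial
  induction hb using Subgroup.closure_induction with
  | mem x hx => obtain ⟨i, rfl⟩ := hx; exact hg i
  | one => exact h1
  | mul x y _ _ hx hy => exact hm x y hx hy
  | inv x _ hx => exact hi x hx

/-- A braid sends each generator to a conjugate of a generator. -/
theorem artin_isConj {n : ℕ} (b : BraidGroup n) :
    ∀ j, IsConj (FreeGroup.of (braidPerm n b j)) (artin n b (.of j)) := by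
  refine braid_induction (p := fun b => ∀ j,
    IsConj (FreeGroup.of (braidPerm n b j)) (artin n b (.of j))) ?_ ?_ ?_ ?_ b
  · intro j
    rw [map_one, map_one]
    exact IsConj.refl _
  · intro i j
    rw [artin_of, braidPerm_of, artinGen_of, artinFun]
    by_cases h1 : j = i.castSucc
    · subst h1
      simp only [Equiv.swap_apply_left, if_true]
      exact isConj_iff.2 ⟨_, rfl⟩
    · by_cases h2 : j = i.succ
      · subst h2
        rw [Equiv.swap_apply_right, if_neg (succ_ne_castSucc' i), if_pos rfl]
      · rw [Equiv.swap_apply_of_ne_of_ne h1 h2, if_neg h1, if_neg h2]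
  · intro a b ha hb j
    simp only [map_mul, Equiv.Perm.mul_apply, MulAut.mul_apply]
    exact (ha _).trans ((artin n a).toMonoidHom.map_isConj (hb j))
  · intro a ha j
    have := (artin n a⁻¹).toMonoidHom.map_isConj (ha (braidPerm n a⁻¹ j))
    simp only [map_inv] at this ⊢
    simpa using this.symm

/-- The product `x_1 x_2 ⋯ x_{n+1}` in the free group. -/
def loopAtInfinity (n : ℕ) : FreeGroup (Fin (n + 1)) :=
  (List.ofFn fun i : Fin (n + 1) => FreeGroup.of i).prod

theorem list_prod_ofFn_congr {G : Type*} [Group G] : ∀ {n : ℕ} (i : Fin n)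
    (f g : Fin (n + 1) → G), (∀ j, j ≠ i.castSucc → j ≠ i.succ → f j = g j) →
    f i.castSucc * f i.succ = g i.castSucc * g i.succ →
    (List.ofFn f).prod = (List.ofFn g).prod
  | 0, i, _, _, _, _ => i.elim0
  | n + 1, i, f, g, h, hi => by
    induction i using Fin.cases with
    | zero =>
      have h2 : (fun j : Fin n => f j.succ.succ) = fun j => g j.succ.succ := by
        funext j
        exact h _ (by simp [Fin.ext_iff]) (by simp [Fin.ext_iff])
      rw [List.ofFn_succ, List.ofFn_succ (f := g), List.ofFn_succ, List.ofFn_succ (f := fun j => g _)]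
      simp only [List.prod_cons, ← mul_assoc, h2]
      congr 1
    | succ i =>
      rw [List.ofFn_succ, List.ofFn_succ (f := g)]
      simp only [List.prod_cons]
      rw [h 0 (by simp [Fin.ext_iff]) (by simp [Fin.ext_iff])]
      congr 1
      apply list_prod_ofFn_congr i
      · intro j h1 h2
        exact h _ (by simpa [Fin.ext_iff] using h1) (by simpa [Fin.ext_iff] using h2)
      · exact hi

/-- The product `x_1 ⋯ x_{n+1}` is fixed by all braids. -/
theorem artin_loopAtInfinity {n : ℕ} (b : BraidGroup n) :
    artin n b (loopAtInfinity n) = loopAtInfinity n := by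
  refine braid_induction (p := fun b => artin n b (loopAtInfinity n) = loopAtInfinity n)
    ?_ ?_ ?_ ?_ b
  · simp
  · intro i
    rw [artin_of, loopAtInfinity, map_list_prod, List.map_ofFn]
    apply list_prod_ofFn_congr i
    · intro j h1 h2
      simp [artinGen_of, artinFun, h1, h2]
    · simp [artinGen_of, artinFun, succ_ne_castSucc']
  · intro a b ha hb
    rw [map_mul, MulAut.mul_apply, hb, ha]
  · intro a ha
    rw [map_inv, MulAut.inv_apply, MulEquiv.symm_apply_eq, ha]

/-- A pure braid does not change the values of a homomorphism to a commutative group. -/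
theorem lift_artin_pure {n : ℕ} {M : Type*} [CommGroup M] (f : FreeGroup (Fin (n + 1)) →* M)
    (b : PureBraidGroup n) (g : FreeGroup (Fin (n + 1))) : f (artin n b g) = f g := by
  suffices h : f.comp (artin n b).toMonoidHom = f from DFunLike.congr_fun h g
  ext j
  have h := f.map_isConj (artin_isConj b.1 j)
  rw [isConj_iff_eq, MonoidHom.mem_ker.1 b.2] at h
  simpa using h.symm

/-! ### The groups `K_0(k,d)` and `Q_0(k,d)` -/

variable {n : ℕ}

/-- `K_0(k,d)`: the kernel of the homomorphism `F_{n+1} → ℤ/d`, `x_i ↦ k_i`. -/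
def K0 (k : Fin (n + 1) → ℕ) (d : ℕ) : Subgroup (FreeGroup (Fin (n + 1))) :=
  (FreeGroup.lift fun i => Multiplicative.ofAdd (k i : ZMod d)).ker

/-- The elements `x_1^d, …, x_{n+1}^d` and `(x_1 ⋯ x_{n+1})^{d/r}`, `r = gcd(∑ k_i, d)`. -/
def punctureLoops (k : Fin (n + 1) → ℕ) (d : ℕ) : Set (FreeGroup (Fin (n + 1))) :=
  insert (loopAtInfinity n ^ (d / Nat.gcd (∑ i, k i) d)) (Set.range fun i => FreeGroup.of i ^ d)

/-- The smallest normal subgroup of `F_{n+1}` containing the elements above. -/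
def N0 (k : Fin (n + 1) → ℕ) (d : ℕ) : Subgroup (FreeGroup (Fin (n + 1))) :=
  Subgroup.normalClosure (punctureLoops k d)

instance (k : Fin (n + 1) → ℕ) (d : ℕ) : (N0 k d).Normal :=
  Subgroup.normalClosure_normal

/-- `Q_0(k,d) = K_0(k,d) / N`; note that `N ≤ K_0(k,d)`, see `N0_le_K0`. -/
abbrev Q0 (k : Fin (n + 1) → ℕ) (d : ℕ) : Type := K0 k d ⧸ (N0 k d).subgroupOf (K0 k d)

theorem N0_le_K0 (k : Fin (n + 1) → ℕ) (d : ℕ) : N0 k d ≤ K0 k d := by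
  have : (K0 k d).Normal := MonoidHom.normal_ker _
  refine Subgroup.normalClosure_le_normal ?_
  intro g hg
  rw [punctureLoops, Set.mem_insert_iff, Set.mem_range] at hg
  rw [SetLike.mem_coe, K0, MonoidHom.mem_ker]
  rcases hg with rfl | ⟨i, rfl⟩
  · rw [map_pow, loopAtInfinity, map_list_prod, List.map_ofFn, List.prod_ofFn]
    simp only [Function.comp_apply, FreeGroup.lift_apply_of]
    rw [← ofAdd_sum, ← ofAdd_nsmul, ofAdd_eq_one, ← Nat.cast_sum, nsmul_eq_mul, ← Nat.cast_mul,
      ZMod.natCast_eq_zero_iff]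
    obtain ⟨c, hc⟩ := Nat.gcd_dvd_left (∑ i, k i) d
    refine ⟨c, ?_⟩
    nth_rewrite 2 [hc]
    rw [← mul_assoc, Nat.div_mul_cancel (Nat.gcd_dvd_right _ _)]
  · rw [map_pow, FreeGroup.lift_apply_of, ← ofAdd_nsmul]
    simp

theorem artin_mem_K0 (k : Fin (n + 1) → ℕ) (d : ℕ) (b : PureBraidGroup n)
    {g : FreeGroup (Fin (n + 1))} (hg : g ∈ K0 k d) : artin n b g ∈ K0 k d := by
  rw [K0, MonoidHom.mem_ker] at hg ⊢
  rw [lift_artin_pure, hg]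

theorem artin_mem_N0 (k : Fin (n + 1) → ℕ) (d : ℕ) (b : PureBraidGroup n)
    {g : FreeGroup (Fin (n + 1))} (hg : g ∈ N0 k d) : artin n b g ∈ N0 k d := by
  suffices h : N0 k d ≤ (N0 k d).comap (artin n b).toMonoidHom from h hg
  refine Subgroup.normalClosure_le_normal ?_
  rintro g hg
  rw [SetLike.mem_coe, Subgroup.mem_comap]
  rw [punctureLoops, Set.mem_insert_iff, Set.mem_range] at hg
  rcases hg with rfl | ⟨i, rfl⟩
  · rw [map_pow]
    simp only [MulEquiv.toMonoidHom_eq_coe, MonoidHom.coe_coe, artin_loopAtInfinity]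
    exact Subgroup.subset_normalClosure (Set.mem_insert _ _)
  · obtain ⟨c, hc⟩ := isConj_iff.1 (artin_isConj b.1 i)
    rw [MonoidHom.mem_ker.1 b.2, Equiv.Perm.one_apply] at hc
    rw [map_pow]
    simp only [MulEquiv.toMonoidHom_eq_coe, MonoidHom.coe_coe, ← hc, conj_pow]
    have hi : FreeGroup.of i ^ d ∈ N0 k d :=
      Subgroup.subset_normalClosure (Set.mem_insert_of_mem _ ⟨i, rfl⟩)
    exact Subgroup.Normal.conj_mem inferInstance _ hi c

/-- The action of a pure braid on `K_0(k,d)`, the restriction of Artin's action. -/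
def artinK0 (k : Fin (n + 1) → ℕ) (d : ℕ) (b : PureBraidGroup n) : K0 k d →* K0 k d :=
  ((artin n b).toMonoidHom.comp (K0 k d).subtype).codRestrict (K0 k d)
    fun g => artin_mem_K0 k d b g.2

/-- The action of the pure braid group on `Q_0(k,d)`, induced by Artin's action. -/
def artinQ0 (k : Fin (n + 1) → ℕ) (d : ℕ) : PureBraidGroup n →* Monoid.End (Q0 k d) where
  toFun b := QuotientGroup.map _ _ (artinK0 k d b) fun g hg => by
    rw [Subgroup.mem_comap, Subgroup.mem_subgroupOf]
    exact artin_mem_N0 k d b (Subgroup.mem_subgroupOf.1 hg)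
  map_one' := by
    ext g
    obtain ⟨g, rfl⟩ := QuotientGroup.mk_surjective g
    have h : artinK0 k d 1 = MonoidHom.id _ := by
      ext x; simp [artinK0]
    simp only [h, QuotientGroup.map_id]
    rfl
  map_mul' a b := by
    ext g
    obtain ⟨g, rfl⟩ := QuotientGroup.mk_surjective g
    have h : artinK0 k d (a * b) = (artinK0 k d a).comp (artinK0 k d b) := by
      ext x; simp [artinK0]
    simp only [h]
    rfl

/-- The first homology group `H_1(Q, ℚ) = Q^{ab} ⊗ ℚ` of a group. -/
abbrev H1Q (Q : Type*) [Group Q] : Type _ := ℚ ⊗[ℤ] Additive (Abelianization Q)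

/-- Functoriality of `H_1(-, ℚ)`: the endomorphisms of a group act on its homology. -/
def H1QRep (Q : Type*) [Group Q] : Representation ℚ (Monoid.End Q) (H1Q Q) where
  toFun f := LinearMap.baseChange ℚ
    (AddMonoidHom.toIntLinearMap (MonoidHom.toAdditive (Abelianization.map f)))
  map_one' := by
    have h : Abelianization.map (1 : Monoid.End Q) = MonoidHom.id _ := Abelianization.map_id
    ext x
    simp [h]
  map_mul' f g := by
    have h : Abelianization.map (f * g) = (Abelianization.map f).comp (Abelianization.map g) :=
      (Abelianization.map_comp (f := g) f).symm
    ext x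
    simp [h]

/-- The representation `X_0` of the pure braid group `P_{n+1}` on `H_1(Q_0(k,d), ℚ)`. -/
def X0 (k : Fin (n + 1) → ℕ) (d : ℕ) : Representation ℚ (PureBraidGroup n) (H1Q (Q0 k d)) :=
  (H1QRep (Q0 k d)).comp (artinQ0 k d)

/-! ### The Gassner representation and the reduced Gassner representation -/

section Gassner

variable {A : Type*} [CommRing A]

/-- Multiplication of vectors by units. -/
def unitsAct (A : Type*) [CommRing A] (n : ℕ) :
    Aˣ →* MulAut (Multiplicative (Fin (n + 1) → A)) :=
  (MulAutMultiplicative (Fin (n + 1) → A)).symm.toMonoidHom.comp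
    (DistribMulAction.toAddAut Aˣ (Fin (n + 1) → A))

/-- The homomorphism `x_i ↦ (e_i, t_i)` from the free group to `A^{n+1} ⋊ Aˣ`, the
specialisation at `X_i ↦ t_i` of the map `x_i ↦ (e_i, X_i)` to `K^{ab} ⋊ F_{n+1}^{ab}`. -/
def magnus (t : Fin (n + 1) → Aˣ) :
    FreeGroup (Fin (n + 1)) →* Multiplicative (Fin (n + 1) → A) ⋊[unitsAct A n] Aˣ :=
  FreeGroup.lift fun i => ⟨Multiplicative.ofAdd (Pi.single i 1), t i⟩

/-- The vector part of `magnus t g`; its coordinates are the Fox derivatives of `g` at `t`. -/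
def vectorPart (t : Fin (n + 1) → Aˣ) (g : FreeGroup (Fin (n + 1))) : Fin (n + 1) → A :=
  Multiplicative.toAdd (magnus t g).left

theorem magnus_right (t : Fin (n + 1) → Aˣ) (g : FreeGroup (Fin (n + 1))) :
    (magnus t g).right = FreeGroup.lift t g := by
  suffices h : SemidirectProduct.rightHom.comp (magnus t) = FreeGroup.lift t from
    DFunLike.congr_fun h g
  ext i
  simp [magnus]

theorem vectorPart_of (t : Fin (n + 1) → Aˣ) (i : Fin (n + 1)) :
    vectorPart t (.of i) = Pi.single i 1 := by
  simp [vectorPart, magnus]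

theorem vectorPart_one (t : Fin (n + 1) → Aˣ) : vectorPart t 1 = 0 := by
  simp [vectorPart]

theorem vectorPart_mul (t : Fin (n + 1) → Aˣ) (g h : FreeGroup (Fin (n + 1))) :
    vectorPart t (g * h) = vectorPart t g + (FreeGroup.lift t g) • vectorPart t h := by
  rw [vectorPart, map_mul, SemidirectProduct.mul_left, magnus_right]
  rfl

theorem vectorPart_inv (t : Fin (n + 1) → Aˣ) (g : FreeGroup (Fin (n + 1))) :
    vectorPart t g⁻¹ = -((FreeGroup.lift t g)⁻¹ • vectorPart t g) := by
  have h := vectorPart_mul t g⁻¹ g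
  rw [inv_mul_cancel, vectorPart_one, map_inv] at h
  exact eq_neg_of_add_eq_zero_left h.symm

/-- The linear map `e_i ↦` (vector part of `b(x_i)`). -/
def gassnerMap (t : Fin (n + 1) → Aˣ) (b : PureBraidGroup n) :
    (Fin (n + 1) → A) →ₗ[A] (Fin (n + 1) → A) :=
  Fintype.linearCombination A fun i => vectorPart t (artin n b (.of i))

theorem gassnerMap_single (t : Fin (n + 1) → Aˣ) (b : PureBraidGroup n) (i : Fin (n + 1)) :
    gassnerMap t b (Pi.single i 1) = vectorPart t (artin n b (.of i)) := by
  rw [gassnerMap, Fintype.linearCombination_apply_single, one_smul]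

theorem gassnerMap_vectorPart (t : Fin (n + 1) → Aˣ) (b : PureBraidGroup n)
    (g : FreeGroup (Fin (n + 1))) :
    gassnerMap t b (vectorPart t g) = vectorPart t (artin n b g) := by
  induction g using FreeGroup.induction_on with
  | C1 => simp [vectorPart_one]
  | of i => rw [vectorPart_of, gassnerMap_single]
  | inv_of i ih =>
    rw [map_inv, vectorPart_inv, vectorPart_inv, lift_artin_pure, ← ih]
    simp only [Units.smul_def, map_neg, map_smul]
  | mul g h hg hh =>
    rw [map_mul, vectorPart_mul, vectorPart_mul, lift_artin_pure, ← hg, ← hh]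
    simp only [Units.smul_def, map_add, map_smul]

/-- The Gassner representation `G_n` of the pure braid group `P_{n+1}` on `A^{n+1}`, at the
parameters `X_i ↦ t_i`: the action of `b` on `x_i = (e_i, t_i)`, read in `A^{n+1} ⋊ Aˣ`. -/
def gassner (t : Fin (n + 1) → Aˣ) :
    Representation A (PureBraidGroup n) (Fin (n + 1) → A) where
  toFun := gassnerMap t
  map_one' := by
    refine LinearMap.pi_ext' fun i => LinearMap.ext_ring ?_
    simp [gassnerMap_single, vectorPart_of]
  map_mul' a b := by
    refine LinearMap.pi_ext' fun i => LinearMap.ext_ring ?_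
    simp [gassnerMap_single, gassnerMap_vectorPart]

/-- The linear form `e_i ↦ 1 - t_i`. -/
def boundary (t : Fin (n + 1) → Aˣ) : (Fin (n + 1) → A) →ₗ[A] A :=
  Fintype.linearCombination A fun i => 1 - (t i : A)

theorem boundary_vectorPart (t : Fin (n + 1) → Aˣ) (g : FreeGroup (Fin (n + 1))) :
    boundary t (vectorPart t g) = 1 - ((FreeGroup.lift t g : Aˣ) : A) := by
  induction g using FreeGroup.induction_on with
  | C1 => simp [vectorPart_one]
  | of i => simp [vectorPart_of, boundary, Fintype.linearCombination_apply_single]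
  | inv_of i ih =>
    rw [vectorPart_inv, Units.smul_def, map_neg, map_smul, ih, map_inv]
    simp [mul_sub]
  | mul g h hg hh =>
    rw [vectorPart_mul, Units.smul_def, map_add, map_smul, hg, hh, map_mul]
    simp [mul_sub]

theorem boundary_gassner (t : Fin (n + 1) → Aˣ) (b : PureBraidGroup n) (w : Fin (n + 1) → A) :
    boundary t (gassner t b w) = boundary t w := by
  suffices h : (boundary t).comp (gassner t b) = boundary t from DFunLike.congr_fun h w
  refine LinearMap.pi_ext' fun i => LinearMap.ext_ring ?_
  have h := boundary_vectorPart t (artin n b (.of i))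
  rw [lift_artin_pure, ← gassnerMap_single, ← boundary_vectorPart, vectorPart_of] at h
  simpa [gassner] using h

/-- The space `W` of the reduced Gassner representation.  If no `t_i` is `1` then, with
`v_i = e_i / (1 - t_i)`, it is the span of the vectors `ε_i = v_i - v_{i+1}`, `1 ≤ i ≤ n`:
see `reducedSpace_eq_span`. -/
def reducedSpace (t : Fin (n + 1) → Aˣ) : Submodule A (Fin (n + 1) → A) :=
  LinearMap.ker (boundary t)

/-- The reduced Gassner representation at the parameters `X_i ↦ t_i`. -/
def reducedGassner (t : Fin (n + 1) → Aˣ) :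
    Representation A (PureBraidGroup n) (reducedSpace t) :=
  (gassner t).subrepresentation (reducedSpace t) fun b w hw => by
    rw [Submodule.mem_comap, reducedSpace, LinearMap.mem_ker, boundary_gassner]
    exact hw

end Gassner

/-- The vector `v_i = e_i / (1 - t_i)`. -/
def vBasis {E : Type*} [Field E] (t : Fin (n + 1) → Eˣ) (i : Fin (n + 1)) : Fin (n + 1) → E :=
  (1 - (t i : E))⁻¹ • Pi.single i 1

theorem reducedSpace_eq_span {E : Type*} [Field E] (t : Fin (n + 1) → Eˣ) (ht : ∀ i, t i ≠ 1) :
    reducedSpace t =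
      Submodule.span E (Set.range fun i : Fin n => vBasis t i.castSucc - vBasis t i.succ) := by
  have hne : ∀ i, 1 - (t i : E) ≠ 0 := fun i h =>
    ht i (Units.ext (by simpa using (sub_eq_zero.1 h).symm))
  have hv : ∀ i, boundary t (vBasis t i) = 1 := fun i => by
    rw [vBasis, map_smul, boundary, Fintype.linearCombination_apply_single, one_smul,
      smul_eq_mul, inv_mul_cancel₀ (hne i)]
  apply le_antisymm
  · intro w hw
    set S := Submodule.span E
      (Set.range fun i : Fin n => vBasis t i.castSucc - vBasis t i.succ) with hS
    have h0 : ∀ i : Fin (n + 1), vBasis t 0 - vBasis t i ∈ S := by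
      intro i
      induction i using Fin.induction with
      | zero => simp
      | succ i ih =>
        have := S.add_mem ih (Submodule.subset_span ⟨i, rfl⟩)
        simpa using this
    have hw' : w = ∑ i, (w i * (1 - (t i : E))) • vBasis t i := by
      conv_lhs => rw [pi_eq_sum_univ' w]
      refine Finset.sum_congr rfl fun i _ => ?_
      rw [vBasis, smul_smul, mul_assoc, mul_inv_cancel₀ (hne i), mul_one]
    have hz : ∑ i, w i * (1 - (t i : E)) = 0 := by
      have := LinearMap.mem_ker.1 hw
      simpa [boundary, Fintype.linearCombination_apply] using this
    have hw'' : w = -∑ i, (w i * (1 - (t i : E))) • (vBasis t 0 - vBasis t i) := by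
      simp only [smul_sub, Finset.sum_sub_distrib, ← Finset.sum_smul, hz, zero_smul, zero_sub,
        neg_neg]
      exact hw'
    rw [hw'']
    exact S.neg_mem (S.sum_mem fun i _ => S.smul_mem _ (h0 i))
  · rw [Submodule.span_le]
    rintro _ ⟨i, rfl⟩
    rw [SetLike.mem_coe, reducedSpace, LinearMap.mem_ker, map_sub, hv, hv, sub_self]

/-! ### Specialisation at roots of unity -/

/-- The primitive `e`-th root of unity `exp(2πi/e)`. -/
def rootExp (e : ℕ) : ℂ := Complex.exp (2 * Real.pi * Complex.I / e)

/-- The cyclotomic field `E_e = ℚ(exp(2πi/e))`. -/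
def Ecyc (e : ℕ) : Type := IntermediateField.adjoin ℚ {rootExp e}

instance (e : ℕ) : Field (Ecyc e) :=
  inferInstanceAs (Field (IntermediateField.adjoin ℚ {rootExp e}))

instance (e : ℕ) : CharZero (Ecyc e) :=
  inferInstanceAs (CharZero (IntermediateField.adjoin ℚ {rootExp e}))

/-- The root of unity `ω_e = exp(2πi/e)` as a unit of `E_e`. -/
def omega (e : ℕ) : (Ecyc e)ˣ :=
  Units.mk0 (IntermediateField.AdjoinSimple.gen ℚ (rootExp e)) fun h =>
    Complex.exp_ne_zero _ (congrArg Subtype.val h)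

/-- The parameters `t_i = ω_e^{k_i}`. -/
def params (k : Fin (n + 1) → ℕ) (e : ℕ) (i : Fin (n + 1)) : (Ecyc e)ˣ := omega e ^ k i

/-- The space `W_n(k,e)` of the representation `g_n(k,e)`. -/
abbrev Wspace (k : Fin (n + 1) → ℕ) (e : ℕ) : Type := reducedSpace (params k e)

/-- The reduced Gassner representation `g_n(k,e)` at `X_i ↦ ω_e^{k_i}`, over `E_e`. -/
def gRed (k : Fin (n + 1) → ℕ) (e : ℕ) :
    Representation (Ecyc e) (PureBraidGroup n) (Wspace k e) :=
  reducedGassner (params k e)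

/-- The quotient of `g_n(k,e)` by its subspace of invariants, over `E_e`. -/
def gBar (k : Fin (n + 1) → ℕ) (e : ℕ) :
    Representation (Ecyc e) (PureBraidGroup n) (Wspace k e ⧸ (gRed k e).invariants) :=
  (gRed k e).quotient (gRed k e).invariants fun b w hw => by
    rw [Submodule.mem_comap, (Representation.mem_invariants _ _).1 hw b]
    exact hw

/-- A representation over an extension field `E` of `ℚ`, seen as a representation over `ℚ`. -/
def restrictToRat {E G V : Type*} [Field E] [CharZero E] [Monoid G] [AddCommGroup V] [Module E V]
    [Module ℚ V] [IsScalarTower ℚ E V] (ρ : Representation E G V) : Representation ℚ G V where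
  toFun g := (ρ g).restrictScalars ℚ
  map_one' := by ext; simp
  map_mul' a b := by ext; simp

end

/-!
Write `χ : F_{n+1} → Aˣ` for `x_i ↦ t_i`, `D(g)` for the vector part of `g` in `A^{n+1} ⋊ Aˣ` and
`∂ : A^{n+1} → A` for the linear form `e_i ↦ 1 - t_i`, so that `∂ D(g) = 1 - χ(g)`. Suppose that
the values of `χ` on `F_{n+1}` form a `ℚ`-basis of `A`, indexed by a quotient `C = F_{n+1} / K`.
Then Schreier's rewriting process, read `ℚ`-linearly, inverts `g ↦ D(g)` and identifies
`H_1(K / N, ℚ)` with `ker ∂` modulo the `A`-span of `D(N)`.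

For `C = ℤ/d` one may take for `A` the product of the fields `E_e`, `e ∣ d`, with `t_i` the family
of the `ω_e^{k_i}`: the minimal polynomial of `(ω_e)_e` is `∏ Φ_e = X^d - 1`. The quotient then
splits into one summand per divisor. At `e = 1` all `t_i` are `1` and `D(x_i^d) = d e_i`, so nothing
is left. At `e ≥ 2` the vectors `D(x_i^d)` vanish, whereas `D((x_1 ⋯ x_{n+1})^{d/r})` spans the
invariants of the reduced Gassner representation: both are the line of `D(x_1 ⋯ x_{n+1})` if
`∏ t_i = 1`, and both are zero if not. Braids act compatibly because the Gassner matrix of `b` sends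
`D(g)` to `D(b(g))`.
-/

noncomputable section

section FoxCalculus

variable {n : ℕ} {A B : Type*} [CommRing A] [CommRing B] (t : Fin (n + 1) → Aˣ)

theorem lift_units_map (f : A →+* B) (g : FreeGroup (Fin (n + 1))) :
    FreeGroup.lift (fun i => Units.map (f : A →* B) (t i)) g =
      Units.map (f : A →* B) (FreeGroup.lift t g) := by
  suffices h : FreeGroup.lift (fun i => Units.map (f : A →* B) (t i)) =
      (Units.map (f : A →* B)).comp (FreeGroup.lift t) from DFunLike.congr_fun h g
  ext1 i
  simp

theorem vectorPart_units_map (f : A →+* B) (g : FreeGroup (Fin (n + 1))) :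
    vectorPart (fun i => Units.map (f : A →* B) (t i)) g = f ∘ vectorPart t g := by
  induction g using FreeGroup.induction_on with
  | C1 => ext j; simp [vectorPart_one]
  | of i => ext j; by_cases h : j = i <;> simp [vectorPart_of, h]
  | inv_of i ih =>
    ext j
    simp [vectorPart_inv, ih, Units.smul_def, ← map_inv]
  | mul g h hg hh =>
    ext j
    simp [vectorPart_mul, lift_units_map, hg, hh, Units.smul_def]

theorem boundary_units_map (f : A →+* B) (v : Fin (n + 1) → A) :
    boundary (fun i => Units.map (f : A →* B) (t i)) (f ∘ v) = f (boundary t v) := by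
  simp [boundary, Fintype.linearCombination_apply]

theorem vectorPart_pow (g : FreeGroup (Fin (n + 1))) (m : ℕ) :
    vectorPart t (g ^ m) =
      (∑ j ∈ Finset.range m, ((FreeGroup.lift t g : Aˣ) : A) ^ j) • vectorPart t g := by
  induction m with
  | zero => simp [vectorPart_one]
  | succ m ih =>
    rw [pow_succ, vectorPart_mul, ih, Finset.sum_range_succ, add_smul, map_pow, Units.smul_def,
      Units.val_pow_eq_pow_val]

theorem vectorPart_conj (g h : FreeGroup (Fin (n + 1))) :
    vectorPart t (g * h * g⁻¹) =
      (1 - ((FreeGroup.lift t h : Aˣ) : A)) • vectorPart t g +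
        ((FreeGroup.lift t g : Aˣ) : A) • vectorPart t h := by
  rw [vectorPart_mul, vectorPart_mul, vectorPart_inv, map_mul, smul_neg, smul_smul,
    mul_comm (FreeGroup.lift t g), mul_inv_cancel_right]
  simp only [Units.smul_def]
  module

theorem lift_loopAtInfinity : FreeGroup.lift t (loopAtInfinity n) = ∏ i, t i := by
  rw [loopAtInfinity, map_list_prod, List.map_ofFn, List.prod_ofFn]
  simp

theorem vectorPart_loopAtInfinity_zero : vectorPart t (loopAtInfinity n) 0 = 1 := by
  have vectorPart_tail : ∀ l : List (Fin n),
      vectorPart t (l.map fun i => FreeGroup.of i.succ).prod 0 = 0 := by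
    intro l
    induction l with
    | nil => simp [vectorPart_one]
    | cons a l ih => simp [vectorPart_mul, vectorPart_of, ih]
  have loop_eq : loopAtInfinity n =
      .of 0 * ((List.ofFn id).map fun i : Fin n => FreeGroup.of i.succ).prod := by
    rw [loopAtInfinity, List.ofFn_succ, List.prod_cons, List.map_ofFn]
    rfl
  rw [loop_eq, vectorPart_mul, Pi.add_apply, Pi.smul_apply, vectorPart_tail, vectorPart_of,
    Pi.single_eq_same, smul_zero, add_zero]

variable {t}

theorem span_vectorPart_normalClosure {s : Set (FreeGroup (Fin (n + 1)))}
    (hs : ∀ g ∈ s, FreeGroup.lift t g = 1) :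
    Submodule.span A (vectorPart t '' Subgroup.normalClosure s) =
      Submodule.span A (vectorPart t '' s) := by
  refine le_antisymm (Submodule.span_le.2 ?_)
    (Submodule.span_mono (Set.image_mono Subgroup.subset_normalClosure))
  rintro _ ⟨g, hg, rfl⟩
  set S := Submodule.span A (vectorPart t '' s)
  suffices h : FreeGroup.lift t g = 1 ∧ vectorPart t g ∈ S from h.2
  induction hg using Subgroup.closure_induction with
  | mem x hx =>
    obtain ⟨a, ha, hc⟩ := Group.mem_conjugatesOfSet_iff.1 hx
    obtain ⟨c, rfl⟩ := isConj_iff.1 hc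
    refine ⟨by simp [hs a ha], ?_⟩
    rw [vectorPart_conj, hs a ha, Units.val_one, sub_self, zero_smul, zero_add]
    exact S.smul_mem _ (Submodule.subset_span ⟨a, ha, rfl⟩)
  | one => simp [vectorPart_one]
  | mul x y _ _ hx hy =>
    refine ⟨by simp [hx.1, hy.1], ?_⟩
    rw [vectorPart_mul, hx.1, one_smul]
    exact S.add_mem hx.2 hy.2
  | inv x _ hx =>
    refine ⟨by simp [hx.1], ?_⟩
    rw [vectorPart_inv, hx.1, inv_one, one_smul]
    exact S.neg_mem hx.2

/-- The map `g ↦ D(g)` on a subgroup of the kernel of `χ`, where it is a homomorphism with values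
in the kernel of the boundary. -/
def reducedVector {K : Subgroup (FreeGroup (Fin (n + 1)))} (hK : K ≤ (FreeGroup.lift t).ker) :
    K →* Multiplicative (reducedSpace t) where
  toFun g := .ofAdd ⟨vectorPart t g, by
    rw [reducedSpace, LinearMap.mem_ker, boundary_vectorPart, MonoidHom.mem_ker.1 (hK g.2),
      Units.val_one, sub_self]⟩
  map_one' := congrArg Multiplicative.ofAdd (Subtype.ext (vectorPart_one t))
  map_mul' g h := congrArg Multiplicative.ofAdd <| Subtype.ext <|
    (vectorPart_mul t g h).trans <| congrArg (vectorPart t g.1 + ·) <|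
      (congrArg (· • vectorPart t h.1) (MonoidHom.mem_ker.1 (hK g.2))).trans (one_smul _ _)

theorem reducedVector_artinK0 {k : Fin (n + 1) → ℕ} {d : ℕ}
    (hK : K0 k d ≤ (FreeGroup.lift t).ker) (b : PureBraidGroup n) (g : K0 k d) :
    (reducedVector hK (artinK0 k d b g)).toAdd =
      reducedGassner t b (reducedVector hK g).toAdd :=
  Subtype.ext (gassnerMap_vectorPart t b g).symm

end FoxCalculus

namespace H1Q

variable {Q : Type*} [Group Q] {H : Type*} [AddCommGroup H] [Module ℚ H]

/-- The class in `H_1(Q, ℚ)` of an element of `Q`. -/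
def of : Q →* Multiplicative (H1Q Q) where
  toFun g := .ofAdd (1 ⊗ₜ Additive.ofMul (Abelianization.of g))
  map_one' := by simp
  map_mul' g h := by simp [TensorProduct.tmul_add]

/-- The universal property of `H_1(Q, ℚ)`: the linear extension of a homomorphism from `Q` to a
rational vector space. -/
def lift (f : Q →* Multiplicative H) : H1Q Q →ₗ[ℚ] H :=
  LinearMap.liftBaseChange ℚ
    (AddMonoidHom.toIntLinearMap (MonoidHom.toAdditiveLeft (Abelianization.lift f)))

theorem lift_of (f : Q →* Multiplicative H) (g : Q) : lift f (of g).toAdd = (f g).toAdd := by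
  change lift f (1 ⊗ₜ _) = _
  rw [lift, LinearMap.liftBaseChange_tmul, one_smul]
  rfl

theorem hom_ext {f f' : H1Q Q →ₗ[ℚ] H} (h : ∀ g : Q, f (of g).toAdd = f' (of g).toAdd) :
    f = f' := by
  ext a
  obtain ⟨g, rfl⟩ := QuotientGroup.mk_surjective a.toMul
  exact h g

end H1Q

theorem H1QRep_of {Q : Type*} [Group Q] (f : Monoid.End Q) (g : Q) :
    H1QRep Q f (H1Q.of g).toAdd = (H1Q.of (f g)).toAdd :=
  rfl

section Schreier

variable {n : ℕ} {C : Type*} [Group C] {φ : FreeGroup (Fin (n + 1)) →* C}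
  (hφ : Function.Surjective φ)

/-- The Schreier element `s(c) g s(c φ(g))⁻¹` of the kernel of `φ`, for `s` a section of `φ`. -/
def schreierElt (c : C) (g : FreeGroup (Fin (n + 1))) : φ.ker :=
  ⟨Function.surjInv hφ c * g * (Function.surjInv hφ (c * φ g))⁻¹, by
    simp [MonoidHom.mem_ker, Function.surjInv_eq]⟩

theorem schreierElt_mul (c : C) (g h : FreeGroup (Fin (n + 1))) :
    schreierElt hφ c (g * h) = schreierElt hφ c g * schreierElt hφ (c * φ g) h := by
  ext
  simp [schreierElt, mul_assoc]

theorem schreierElt_one (c : C) : schreierElt hφ c 1 = 1 := by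
  ext
  simp [schreierElt]

theorem schreierElt_inv (c : C) (g : FreeGroup (Fin (n + 1))) :
    schreierElt hφ c g⁻¹ = (schreierElt hφ (c * φ g⁻¹) g)⁻¹ := by
  rw [eq_inv_iff_mul_eq_one, ← schreierElt_mul, inv_mul_cancel, schreierElt_one]

theorem coe_schreierElt_of_mem_ker (c : C) {g : FreeGroup (Fin (n + 1))} (hg : g ∈ φ.ker) :
    (schreierElt hφ c g : FreeGroup (Fin (n + 1))) =
      Function.surjInv hφ c * g * (Function.surjInv hφ c)⁻¹ := by
  simp [schreierElt, MonoidHom.mem_ker.1 hg]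

variable {R A : Type*} [CommRing R] [CommRing A] [Algebra R A] {t : Fin (n + 1) → Aˣ}
  {b : Module.Basis C R A} {H : Type*} [AddCommGroup H] [Module R H]
  (κ : φ.ker →* Multiplicative H)

/-- The linear extension to `A^{n+1}` of a homomorphism `κ` on the kernel of `φ`: the basis vector
`c e_i` goes to the value of `κ` at the Schreier generator attached to `c` and `x_i`. -/
def foxRetraction (b : Module.Basis C R A) : (Fin (n + 1) → A) →ₗ[R] H :=
  (Pi.basis fun _ => b).constr R fun p => (κ (schreierElt hφ p.2 (.of p.1))).toAdd

theorem foxRetraction_single (c : C) (i : Fin (n + 1)) :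
    foxRetraction hφ κ b (Pi.single i (b c)) = (κ (schreierElt hφ c (.of i))).toAdd := by
  rw [← Pi.basis_apply (fun _ => b) ⟨i, c⟩, foxRetraction, Module.Basis.constr_basis]

theorem comp_foxRetraction {H' : Type*} [AddCommGroup H'] [Module R H'] (f : H →ₗ[R] H') :
    f ∘ₗ foxRetraction hφ κ b =
      foxRetraction hφ (f.toAddMonoidHom.toMultiplicative.comp κ) b := by
  refine (Pi.basis fun _ => b).ext fun p => ?_
  simp only [LinearMap.comp_apply, Pi.basis_apply, foxRetraction_single]
  rfl

variable (hb : ∀ g, b (φ g) = (FreeGroup.lift t g : A))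

include hb

theorem ker_le_ker_lift : φ.ker ≤ (FreeGroup.lift t).ker := fun g hg => by
  rw [MonoidHom.mem_ker, Units.ext_iff, ← hb, MonoidHom.mem_ker.1 hg, ← map_one φ, hb, map_one]

include hφ in
theorem basis_mul_lift (c : C) (g : FreeGroup (Fin (n + 1))) :
    b c * (FreeGroup.lift t g : A) = b (c * φ g) := by
  obtain ⟨h, rfl⟩ := hφ c
  rw [← map_mul φ, hb, hb, map_mul, Units.val_mul]

theorem foxRetraction_basis_smul_vectorPart (g : FreeGroup (Fin (n + 1))) (c : C) :
    foxRetraction hφ κ b (b c • vectorPart t g) = (κ (schreierElt hφ c g)).toAdd := by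
  induction g using FreeGroup.induction_on generalizing c with
  | C1 => simp [vectorPart_one, schreierElt_one]
  | of i =>
    rw [vectorPart_of, ← foxRetraction_single (b := b), ← Pi.single_smul, smul_eq_mul, mul_one]
  | inv_of i ih =>
    rw [vectorPart_inv, ← map_inv, smul_neg, map_neg, Units.smul_def, smul_smul,
      basis_mul_lift hφ hb, ih, schreierElt_inv, map_inv κ, toAdd_inv]
  | mul g h hg hh =>
    rw [vectorPart_mul, smul_add, map_add, hg, Units.smul_def, smul_smul, basis_mul_lift hφ hb, hh,
      schreierElt_mul, map_mul, toAdd_mul]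

theorem foxRetraction_vectorPart (g : φ.ker) :
    foxRetraction hφ κ b (vectorPart t g) = (κ g).toAdd := by
  have basis_one : b 1 = 1 := by rw [← map_one φ, hb, map_one, Units.val_one]
  let s₁ : φ.ker := ⟨Function.surjInv hφ 1, Function.surjInv_eq hφ 1⟩
  have conj : schreierElt hφ 1 g = s₁ * g * s₁⁻¹ :=
    Subtype.ext (coe_schreierElt_of_mem_ker hφ 1 g.2)
  rw [← one_smul A (vectorPart t g), ← basis_one, foxRetraction_basis_smul_vectorPart hφ κ hb, conj,
    map_mul κ, map_mul κ, map_inv, mul_inv_cancel_comm]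

theorem foxRetraction_eq_zero_of_mem_span {N : Subgroup (FreeGroup (Fin (n + 1)))} [N.Normal]
    (hN : N ≤ φ.ker) (hκ : ∀ g : φ.ker, (g : FreeGroup (Fin (n + 1))) ∈ N → κ g = 1)
    {v : Fin (n + 1) → A} (hv : v ∈ Submodule.span A (vectorPart t '' N)) :
    foxRetraction hφ κ b v = 0 := by
  rw [← Submodule.restrictScalars_mem R, ← Submodule.span_smul_of_span_eq_top b.span_eq] at hv
  refine (Submodule.span_le.2 ?_ : _ ≤ LinearMap.ker (foxRetraction hφ κ b)) hv
  rintro _ ⟨_, ⟨c, rfl⟩, _, ⟨g, hg, rfl⟩, rfl⟩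
  have conj_mem : (schreierElt hφ c g : FreeGroup (Fin (n + 1))) ∈ N := by
    rw [coe_schreierElt_of_mem_ker hφ c (hN hg)]
    exact Subgroup.Normal.conj_mem inferInstance g hg _
  refine LinearMap.mem_ker.2 ?_
  simp only [foxRetraction_basis_smul_vectorPart hφ κ hb, hκ _ conj_mem, toAdd_one]

theorem vectorPart_schreierElt_of (c : C) (i : Fin (n + 1)) :
    vectorPart t (schreierElt hφ c (.of i)) = Pi.single i (b c) +
      (vectorPart t (Function.surjInv hφ c) -
        vectorPart t (Function.surjInv hφ (c * φ (.of i)))) := by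
  have lift_section (c : C) : (FreeGroup.lift t (Function.surjInv hφ c) : A) = b c := by
    rw [← hb, Function.surjInv_eq hφ]
  have lift_eq : FreeGroup.lift t (Function.surjInv hφ c * .of i) =
      FreeGroup.lift t (Function.surjInv hφ (c * φ (.of i))) := by
    rw [Units.ext_iff, lift_section, ← hb, map_mul, Function.surjInv_eq hφ]
  rw [schreierElt, vectorPart_mul, vectorPart_mul, vectorPart_inv, lift_eq, smul_neg,
    smul_inv_smul, vectorPart_of, Units.smul_def, lift_section, ← Pi.single_smul, smul_eq_mul,
    mul_one]
  abel

-- With `σ (b c) = D (s c)`, the Schreier generators satisfy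
-- `D (s(c) x_i s(c φ(x_i))⁻¹) = c e_i + σ (∂ (c e_i))`, so the retraction is `id + σ ∘ ∂`.
theorem foxRetraction_reducedVector_of_mem (v : reducedSpace t) :
    foxRetraction hφ (reducedVector (ker_le_ker_lift hb)) b v = v := by
  let σ : A →ₗ[R] (Fin (n + 1) → A) := b.constr R fun c => vectorPart t (Function.surjInv hφ c)
  have σ_basis (c : C) : σ (b c) = vectorPart t (Function.surjInv hφ c) := b.constr_basis R _ c
  have retraction_eq : (reducedSpace t).subtype.restrictScalars R ∘ₗ
      foxRetraction hφ (reducedVector (ker_le_ker_lift hb)) b =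
        LinearMap.id + σ ∘ₗ (boundary t).restrictScalars R := by
    refine (Pi.basis fun _ => b).ext fun ⟨i, c⟩ => ?_
    have boundary_single : boundary t (Pi.single i (b c)) = b c - b (c * φ (.of i)) := by
      rw [boundary, Fintype.linearCombination_apply_single, smul_eq_mul, mul_sub, mul_one,
        ← basis_mul_lift hφ hb, FreeGroup.lift_apply_of]
    simp only [Pi.basis_apply, LinearMap.comp_apply, foxRetraction_single, LinearMap.add_apply,
      LinearMap.restrictScalars_apply, boundary_single, map_sub, σ_basis]
    exact vectorPart_schreierElt_of hφ hb c i
  exact Subtype.ext <| by simpa [LinearMap.mem_ker.1 v.2] using DFunLike.congr_fun retraction_eq v.1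

variable (R t) in
/-- The span over `A` of the vectors `D(g)`, `g ∈ N`, as an `R`-submodule of the reduced space. -/
def relationSpace (N : Subgroup (FreeGroup (Fin (n + 1)))) : Submodule R (reducedSpace t) :=
  ((Submodule.span A (vectorPart t '' N)).submoduleOf (reducedSpace t)).restrictScalars R

end Schreier

section Presentation

variable {n : ℕ} {C : Type*} [Group C] {φ : FreeGroup (Fin (n + 1)) →* C}
  (hφ : Function.Surjective φ) {A : Type*} [CommRing A] [Algebra ℚ A] {t : Fin (n + 1) → Aˣ}
  {b : Module.Basis C ℚ A} (hb : ∀ g, b (φ g) = (FreeGroup.lift t g : A))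
  {N : Subgroup (FreeGroup (Fin (n + 1)))} [N.Normal] (hN : N ≤ φ.ker)

/-- The linear map `H_1(ker φ / N, ℚ) → ker ∂ / ⟨D(N)⟩` induced by `D`. -/
def h1ToQuotient : H1Q (φ.ker ⧸ N.subgroupOf φ.ker) →ₗ[ℚ] reducedSpace t ⧸ relationSpace ℚ t N :=
  H1Q.lift <| QuotientGroup.lift _
    ((relationSpace ℚ t N).mkQ.toAddMonoidHom.toMultiplicative.comp
      (reducedVector (ker_le_ker_lift hb))) fun g hg => congrArg Multiplicative.ofAdd <|
        (Submodule.Quotient.mk_eq_zero _).2 <|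
          Submodule.subset_span ⟨g, Subgroup.mem_subgroupOf.1 hg, rfl⟩

theorem h1ToQuotient_of_mk (g : φ.ker) :
    h1ToQuotient (N := N) hb (H1Q.of (QuotientGroup.mk g)).toAdd =
      Submodule.Quotient.mk (reducedVector (ker_le_ker_lift hb) g).toAdd := by
  rw [h1ToQuotient, H1Q.lift_of]
  rfl

/-- The linear map `ker ∂ / ⟨D(N)⟩ → H_1(ker φ / N, ℚ)` which sends the class of `D(g)` to the
class of `g`. -/
def quotientToH1 : reducedSpace t ⧸ relationSpace ℚ t N →ₗ[ℚ] H1Q (φ.ker ⧸ N.subgroupOf φ.ker) :=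
  (relationSpace ℚ t N).liftQ
    (foxRetraction hφ (H1Q.of.comp (QuotientGroup.mk' (N.subgroupOf φ.ker))) b ∘ₗ
      (reducedSpace t).subtype.restrictScalars ℚ) fun v hv =>
    foxRetraction_eq_zero_of_mem_span hφ _ hb hN (hv := hv) fun g hg => by
      rw [MonoidHom.comp_apply, QuotientGroup.mk'_apply, (QuotientGroup.eq_one_iff g).2 hg,
        map_one]

/-- Crowell's exact sequence, in rational homology: `H_1(ker φ / N, ℚ)` is the kernel of the
boundary modulo the vectors `D(g)`, `g ∈ N`. -/
def h1Equiv : H1Q (φ.ker ⧸ N.subgroupOf φ.ker) ≃ₗ[ℚ] reducedSpace t ⧸ relationSpace ℚ t N :=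
  LinearEquiv.ofLinearMap (h1ToQuotient hb) (quotientToH1 hφ hb hN)
    (by
      refine Submodule.linearMap_qext _ (LinearMap.ext fun v => ?_)
      have naturality :
          (h1ToQuotient hb).toAddMonoidHom.toMultiplicative.comp
              (H1Q.of.comp (QuotientGroup.mk' (N.subgroupOf φ.ker))) =
            (relationSpace ℚ t N).mkQ.toAddMonoidHom.toMultiplicative.comp
              (reducedVector (ker_le_ker_lift hb)) :=
        MonoidHom.ext fun g => h1ToQuotient_of_mk hb g
      change (h1ToQuotient hb ∘ₗ foxRetraction hφ _ b) v.1 = _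
      rw [comp_foxRetraction, naturality, ← comp_foxRetraction, LinearMap.comp_apply,
        foxRetraction_reducedVector_of_mem hφ hb]
      rfl)
    (H1Q.hom_ext fun g => by
      obtain ⟨g, rfl⟩ := QuotientGroup.mk_surjective g
      rw [LinearMap.comp_apply, h1ToQuotient_of_mk]
      exact foxRetraction_vectorPart hφ _ hb g)

end Presentation

section Invariants

variable {n : ℕ} {A : Type*} [CommRing A] (t : Fin (n + 1) → Aˣ)

theorem vectorPart_loopAtInfinity_mem_invariants :
    vectorPart t (loopAtInfinity n) ∈ (gassner t).invariants := fun b =>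
  (gassnerMap_vectorPart t b _).trans (by rw [artin_loopAtInfinity])

/-- The square of the generator `s_i`, as a pure braid. -/
def sqBraid (i : Fin n) : PureBraidGroup n :=
  ⟨PresentedGroup.of i * PresentedGroup.of i, by
    rw [MonoidHom.mem_ker, map_mul, braidPerm_of, Equiv.swap_mul_self]⟩

theorem artin_sqBraid_castSucc (i : Fin n) :
    artin n (sqBraid i) (.of i.castSucc) =
      (.of i.castSucc * .of i.succ) * .of i.castSucc * (.of i.castSucc * .of i.succ)⁻¹ := by
  simp [sqBraid, artin_of, artinGen_of, artinFun, succ_ne_castSucc', mul_assoc]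

theorem artin_sqBraid_succ (i : Fin n) :
    artin n (sqBraid i) (.of i.succ) = .of i.castSucc * .of i.succ * (.of i.castSucc)⁻¹ := by
  simp [sqBraid, artin_of, artinGen_of, artinFun, succ_ne_castSucc']

theorem artin_sqBraid_of_ne {i : Fin n} {j : Fin (n + 1)} (h : j ≠ i.castSucc)
    (h' : j ≠ i.succ) : artin n (sqBraid i) (.of j) = .of j := by
  simp [sqBraid, artin_of, artinGen_of, artinFun, h, h']

theorem gassner_sqBraid_succ (i : Fin n) (w : Fin (n + 1) → A) :
    gassner t (sqBraid i) w i.succ =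
      w i.succ + (1 - (t i.castSucc : A)) * (t i.castSucc * w i.castSucc - w i.succ) := by
  change gassnerMap t (sqBraid i) w i.succ = _
  rw [gassnerMap, Fintype.linearCombination_apply, Finset.sum_apply,
    Fintype.sum_eq_add i.castSucc i.succ (succ_ne_castSucc' i).symm]
  · rw [artin_sqBraid_castSucc, artin_sqBraid_succ, Pi.smul_apply, Pi.smul_apply, vectorPart_conj,
      vectorPart_conj, vectorPart_mul]
    simp only [vectorPart_of, Units.smul_def, Pi.add_apply, Pi.smul_apply, Pi.single_eq_same,
      Pi.single_eq_of_ne (succ_ne_castSucc' i), FreeGroup.lift_apply_of, smul_eq_mul]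
    ring
  · rintro j ⟨h, h'⟩
    rw [artin_sqBraid_of_ne h h', vectorPart_of, Pi.smul_apply, Pi.single_eq_of_ne h'.symm,
      smul_zero]

theorem invariants_reducedGassner :
    (reducedGassner t).invariants = (gassner t).invariants.submoduleOf (reducedSpace t) := by
  ext w
  simp only [Submodule.submoduleOf, Submodule.mem_comap, Representation.mem_invariants,
    Subtype.ext_iff]
  rfl

variable {t}

theorem vectorPart_pow_of_lift_eq_one {g : FreeGroup (Fin (n + 1))}
    (hg : FreeGroup.lift t g = 1) (m : ℕ) : vectorPart t (g ^ m) = (m : A) • vectorPart t g := by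
  simp [vectorPart_pow, hg]

theorem vectorPart_loopAtInfinity_mem_reducedSpace (h : ∏ i, t i = 1) :
    vectorPart t (loopAtInfinity n) ∈ reducedSpace t := by
  rw [reducedSpace, LinearMap.mem_ker, boundary_vectorPart, lift_loopAtInfinity, h, Units.val_one,
    sub_self]

section IsDomain

variable [IsDomain A]

theorem vectorPart_pow_eq_zero {g : FreeGroup (Fin (n + 1))} {m : ℕ}
    (hg : FreeGroup.lift t g ≠ 1) (hgm : FreeGroup.lift t g ^ m = 1) :
    vectorPart t (g ^ m) = 0 := by
  have geom_sum_mul_eq_zero : (∑ j ∈ Finset.range m, (FreeGroup.lift t g : A) ^ j) *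
      ((FreeGroup.lift t g : A) - 1) = 0 := by
    rw [geom_sum_mul, ← Units.val_pow_eq_pow_val, hgm, Units.val_one, sub_self]
  rw [vectorPart_pow, (mul_eq_zero.1 geom_sum_mul_eq_zero).resolve_right
    (sub_ne_zero.2 (Units.val_eq_one.not.2 hg)), zero_smul]

-- An invariant vector is fixed by the squares `s_i²`, which forces `w_{i+1} = t_i w_i`.
theorem invariants_gassner (ht : ∀ i, t i ≠ 1) :
    (gassner t).invariants = Submodule.span A {vectorPart t (loopAtInfinity n)} := by
  have recursion : ∀ w ∈ (gassner t).invariants, ∀ i : Fin n,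
      w i.succ = t i.castSucc * w i.castSucc := by
    intro w hw i
    have h := gassner_sqBraid_succ t i w
    rw [hw (sqBraid i), left_eq_add, mul_eq_zero,
      or_iff_right (sub_ne_zero.2 (Ne.symm (Units.val_eq_one.not.2 (ht _)))), sub_eq_zero] at h
    exact h.symm
  refine le_antisymm (fun w hw => Submodule.mem_span_singleton.2 ⟨w 0, ?_⟩)
    ((Submodule.span_singleton_le_iff_mem _ _).2 (vectorPart_loopAtInfinity_mem_invariants t))
  funext j
  induction j using Fin.induction with
  | zero => simp [vectorPart_loopAtInfinity_zero]
  | succ i ih =>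
    rw [recursion w hw, ← ih, Pi.smul_apply, Pi.smul_apply,
      recursion _ (vectorPart_loopAtInfinity_mem_invariants t), smul_eq_mul, smul_eq_mul,
      mul_left_comm]

theorem invariants_reducedGassner_eq_bot (ht : ∀ i, t i ≠ 1) (h : ∏ i, t i ≠ 1) :
    (reducedGassner t).invariants = ⊥ := by
  rw [invariants_reducedGassner, invariants_gassner ht, Submodule.submoduleOf, Submodule.eq_bot_iff]
  intro w hw
  obtain ⟨a, ha⟩ := Submodule.mem_span_singleton.1 hw
  have boundary_eq_zero : a * (1 - ((∏ i, t i : Aˣ) : A)) = 0 := by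
    rw [← lift_loopAtInfinity, ← boundary_vectorPart, ← smul_eq_mul, ← map_smul, ha]
    exact w.2
  rw [(mul_eq_zero.1 boundary_eq_zero).resolve_right
    (sub_ne_zero.2 (Ne.symm (Units.val_eq_one.not.2 h))), zero_smul] at ha
  exact Subtype.ext ha.symm

end IsDomain

variable {E : Type*} [Field E] {t : Fin (n + 1) → Eˣ}

theorem finrank_invariants_reducedGassner (ht : ∀ i, t i ≠ 1) [Decidable (∏ i, t i = 1)] :
    Module.finrank E (reducedGassner t).invariants = if ∏ i, t i = 1 then 1 else 0 := by
  split_ifs with h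
  · have loop_ne_zero : vectorPart t (loopAtInfinity n) ≠ 0 := fun h₀ =>
      one_ne_zero ((vectorPart_loopAtInfinity_zero t).symm.trans (congrFun h₀ 0))
    rw [invariants_reducedGassner, invariants_gassner ht,
      (Submodule.submoduleOfEquivOfLe ((Submodule.span_singleton_le_iff_mem _ _).2
        (vectorPart_loopAtInfinity_mem_reducedSpace h))).finrank_eq,
      finrank_span_singleton loop_ne_zero]
  · rw [invariants_reducedGassner_eq_bot ht h, finrank_bot]

theorem span_vectorPart_submoduleOf_eq_invariants {d m : ℕ} (ht : ∀ i, t i ≠ 1)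
    (htd : ∀ i, t i ^ d = 1) (hm : (∏ i, t i) ^ m = 1) (hm₀ : (m : E) ≠ 0) :
    (Submodule.span E (vectorPart t '' insert (loopAtInfinity n ^ m)
      (Set.range fun i => FreeGroup.of i ^ d))).submoduleOf (reducedSpace t) =
        (reducedGassner t).invariants := by
  have vectorPart_of_pow : (vectorPart t ∘ fun i => .of i ^ d) = fun _ => 0 := funext fun i =>
    vectorPart_pow_eq_zero (by simpa using ht i) (by simpa using htd i)
  have span_eq : Submodule.span E (vectorPart t '' insert (loopAtInfinity n ^ m)
      (Set.range fun i => FreeGroup.of i ^ d)) =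
        Submodule.span E {vectorPart t (loopAtInfinity n ^ m)} := by
    rw [Set.image_insert_eq, ← Set.range_comp, vectorPart_of_pow, Set.range_const, Set.pair_comm,
      Submodule.span_insert_zero]
  rw [span_eq]
  by_cases h : ∏ i, t i = 1
  · rw [vectorPart_pow_of_lift_eq_one ((lift_loopAtInfinity t).trans h),
      Submodule.span_singleton_smul_eq hm₀.isUnit, invariants_reducedGassner,
      invariants_gassner ht]
  · rw [invariants_reducedGassner_eq_bot ht h, vectorPart_pow_eq_zero
      (by rwa [lift_loopAtInfinity]) (by rwa [lift_loopAtInfinity]), Submodule.span_zero_singleton,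
      Submodule.submoduleOf, Submodule.comap_bot, Submodule.ker_subtype]

theorem span_vectorPart_of_pow_eq_top {d : ℕ} (ht : ∀ i, t i = 1) (hd : (d : E) ≠ 0) :
    Submodule.span E (vectorPart t '' Set.range fun i => FreeGroup.of i ^ d) = ⊤ := by
  have of_pow (i : Fin (n + 1)) :
      (d : E)⁻¹ • vectorPart t (.of i ^ d) = Pi.basisFun E (Fin (n + 1)) i := by
    rw [vectorPart_pow_of_lift_eq_one (by simpa using ht i), inv_smul_smul₀ hd, vectorPart_of,
      Pi.basisFun_apply]
  rw [← top_le_iff, ← (Pi.basisFun E (Fin (n + 1))).span_eq, Submodule.span_le]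
  rintro _ ⟨i, rfl⟩
  rw [← of_pow]
  exact Submodule.smul_mem _ _ (Submodule.subset_span ⟨_, ⟨i, rfl⟩, rfl⟩)

end Invariants

section PiComponent

variable {D : Type*} {R : D → Type*} [∀ e, CommRing (R e)] {ι : Type*}

instance (e : D) : RingHomSurjective (Pi.evalRingHom R e) := ⟨Function.surjective_eval e⟩

/-- The component at `e` of a vector with coordinates in a product of rings, as a linear map over
the projection of that product. -/
def piComponent (e : D) : (ι → ∀ e, R e) →ₛₗ[Pi.evalRingHom R e] (ι → R e) where
  toFun v i := v i e
  map_add' _ _ := rfl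
  map_smul' _ _ := rfl

-- `v = ∑ e, 1_e w_e` for the idempotents `1_e` and any `w_e` with the same component at `e`.
theorem mem_iff_forall_piComponent_mem_map [Finite D] {p : Submodule (∀ e, R e) (ι → ∀ e, R e)}
    {v : ι → ∀ e, R e} : v ∈ p ↔ ∀ e, piComponent e v ∈ p.map (piComponent e) := by
  classical
  refine ⟨fun hv e => Submodule.mem_map_of_mem hv, fun h => ?_⟩
  have := Fintype.ofFinite D
  choose w hwp hw using h
  have v_eq : v = ∑ e, (Pi.single e 1 : ∀ e, R e) • w e := by
    ext i e
    have hwe : w e i e = v i e := congrFun (hw e) i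
    simp only [Finset.sum_apply, Pi.smul_apply, smul_eq_mul, Pi.mul_apply]
    rw [Fintype.sum_eq_single e fun e' h => by rw [Pi.single_eq_of_ne h.symm, zero_mul],
      Pi.single_eq_same, one_mul, hwe]
  exact v_eq ▸ p.sum_mem fun e _ => p.smul_mem _ (hwp e)

variable {n : ℕ} (τ : ∀ e, Fin (n + 1) → (R e)ˣ)

/-- Parameters in a product of rings, assembled from parameters `τ e` in each of the factors. -/
def piParams (i : Fin (n + 1)) : (∀ e, R e)ˣ := MulEquiv.piUnits.symm fun e => τ e i

theorem piParams_apply (e : D) (i : Fin (n + 1)) : (piParams τ i : ∀ e, R e) e = τ e i := rfl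

theorem units_map_piParams (e : D) :
    (fun i => Units.map (Pi.evalRingHom R e : (∀ e, R e) →* R e) (piParams τ i)) = τ e := rfl

theorem lift_piParams_apply (e : D) (g : FreeGroup (Fin (n + 1))) :
    (FreeGroup.lift (piParams τ) g : ∀ e, R e) e = FreeGroup.lift (τ e) g := by
  rw [← units_map_piParams τ e, lift_units_map]
  rfl

theorem piComponent_vectorPart (e : D) (g : FreeGroup (Fin (n + 1))) :
    piComponent e (vectorPart (piParams τ) g) = vectorPart (τ e) g := by
  rw [← units_map_piParams τ e, vectorPart_units_map]
  rfl

theorem piComponent_mem_reducedSpace (e : D) {v : Fin (n + 1) → ∀ e, R e}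
    (hv : v ∈ reducedSpace (piParams τ)) : piComponent e v ∈ reducedSpace (τ e) :=
  (boundary_units_map (piParams τ) (Pi.evalRingHom R e) v).trans <| by
    rw [LinearMap.mem_ker.1 hv, map_zero]

theorem mem_reducedSpace_piParams {v : Fin (n + 1) → ∀ e, R e} :
    v ∈ reducedSpace (piParams τ) ↔ ∀ e, piComponent e v ∈ reducedSpace (τ e) :=
  ⟨fun hv e => piComponent_mem_reducedSpace τ e hv, fun h => funext fun e =>
    (boundary_units_map (piParams τ) (Pi.evalRingHom R e) v).symm.trans (h e)⟩

theorem mem_span_vectorPart_piParams [Finite D] {s : Set (FreeGroup (Fin (n + 1)))}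
    {v : Fin (n + 1) → ∀ e, R e} :
    v ∈ Submodule.span (∀ e, R e) (vectorPart (piParams τ) '' s) ↔
      ∀ e, piComponent e v ∈ Submodule.span (R e) (vectorPart (τ e) '' s) := by
  simp only [mem_iff_forall_piComponent_mem_map (v := v), Submodule.map_span, Set.image_image,
    piComponent_vectorPart]

end PiComponent

section CyclotomicProduct

theorem isPrimitiveRoot_omega {e : ℕ} (he : e ≠ 0) : IsPrimitiveRoot (omega e) e :=
  IsPrimitiveRoot.coe_units_iff.1 <| IsPrimitiveRoot.of_map_of_injective
    (f := (IntermediateField.adjoin ℚ {rootExp e}).val) (Complex.isPrimitiveRoot_exp e he)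
    Subtype.val_injective

theorem finrank_Ecyc {e : ℕ} (he : e ≠ 0) : Module.finrank ℚ (Ecyc e) = e.totient := by
  have primitive : IsPrimitiveRoot (rootExp e) e := Complex.isPrimitiveRoot_exp e he
  have pos : 0 < e := Nat.pos_of_ne_zero he
  calc Module.finrank ℚ (Ecyc e)
      = Module.finrank ℚ (IntermediateField.adjoin ℚ {rootExp e}) := by congr!
    _ = e.totient := by
      rw [IntermediateField.adjoin.finrank (primitive.isIntegral pos).tower_top,
        ← Polynomial.cyclotomic_eq_minpoly_rat primitive pos, Polynomial.natDegree_cyclotomic]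

instance (e : ℕ) [NeZero e] : FiniteDimensional ℚ (Ecyc e) :=
  FiniteDimensional.of_finrank_pos <| by
    rw [finrank_Ecyc (NeZero.ne e)]
    exact Nat.totient_pos.2 (NeZero.pos e)

theorem cyclotomic_dvd_of_aeval_omega_eq_zero {e : ℕ} (he : e ≠ 0) {p : Polynomial ℚ}
    (hp : Polynomial.aeval (omega e : Ecyc e) p = 0) : Polynomial.cyclotomic e ℚ ∣ p := by
  rw [Polynomial.cyclotomic_eq_minpoly_rat
    (IsPrimitiveRoot.coe_units_iff.2 (isPrimitiveRoot_omega he)) (Nat.pos_of_ne_zero he)]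
  exact minpoly.dvd ℚ _ hp

/-- The product of the cyclotomic fields `E_e` for `e` dividing `d`, isomorphic to the group
algebra of `ℤ/d` over `ℚ`. -/
abbrev CycProd (d : ℕ) : Type := ∀ e : d.divisors, Ecyc e

/-- The element `(ω_e)_e` of the product of the cyclotomic fields. -/
def cycGen (d : ℕ) : (CycProd d)ˣ := MulEquiv.piUnits.symm fun e => omega e

theorem cycGen_pow_apply {d : ℕ} (m : ℕ) (e : d.divisors) :
    ((cycGen d ^ m : (CycProd d)ˣ) : CycProd d) e = (omega e ^ m : (Ecyc e)ˣ) := by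
  simp [cycGen]

instance {d : ℕ} (e : d.divisors) : NeZero e.1 := ⟨(Nat.pos_of_mem_divisors e.2).ne'⟩

theorem cycGen_pow_self (d : ℕ) : cycGen d ^ d = 1 := by
  ext e
  rw [cycGen_pow_apply, ((isPrimitiveRoot_omega (NeZero.ne e.1)).pow_eq_one_iff_dvd d).2
    (Nat.dvd_of_mem_divisors e.2)]
  rfl

theorem aeval_cycGen_apply {d : ℕ} (p : Polynomial ℚ) (e : d.divisors) :
    Polynomial.aeval (cycGen d : CycProd d) p e = Polynomial.aeval (omega e : Ecyc e) p :=
  (Polynomial.aeval_algHom_apply (Pi.evalAlgHom ℚ (fun e : d.divisors => Ecyc e) e) _ p).symm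

theorem X_pow_sub_one_dvd_of_aeval_cycGen_eq_zero {d : ℕ} (hd : 0 < d) {p : Polynomial ℚ}
    (hp : Polynomial.aeval (cycGen d : CycProd d) p = 0) : Polynomial.X ^ d - 1 ∣ p := by
  rw [← Polynomial.prod_cyclotomic_eq_X_pow_sub_one hd]
  refine Finset.prod_dvd_of_coprime
    (fun a _ b _ hab => Polynomial.cyclotomic.isCoprime_rat hab) fun e he =>
      cyclotomic_dvd_of_aeval_omega_eq_zero (Nat.pos_of_mem_divisors he).ne' ?_
  rw [← aeval_cycGen_apply p ⟨e, he⟩, hp, Pi.zero_apply]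

theorem minpoly_cycGen (d : ℕ) [NeZero d] :
    minpoly ℚ (cycGen d : CycProd d) = Polynomial.X ^ d - 1 := by
  have monic : (Polynomial.X ^ d - 1 : Polynomial ℚ).Monic :=
    Polynomial.monic_X_pow_sub_C 1 (NeZero.ne d)
  refine (minpoly.unique ℚ _ monic ?_ fun q hq hq₀ => ?_).symm
  · rw [map_sub, map_pow, Polynomial.aeval_X, map_one, ← Units.val_pow_eq_pow_val,
      cycGen_pow_self, Units.val_one, sub_self]
  · exact Polynomial.degree_le_of_dvd
      (X_pow_sub_one_dvd_of_aeval_cycGen_eq_zero (NeZero.pos d) hq₀) hq.ne_zero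

theorem linearIndependent_cycGen_pow (d : ℕ) [NeZero d] :
    LinearIndependent ℚ fun c : Multiplicative (ZMod d) =>
      ((cycGen d ^ c.toAdd.val : (CycProd d)ˣ) : CycProd d) := by
  have natDegree_eq : (minpoly ℚ (cycGen d : CycProd d)).natDegree = d := by
    rw [minpoly_cycGen, ← Polynomial.C_1, Polynomial.natDegree_X_pow_sub_C]
  refine (linearIndependent_pow (K := ℚ) (cycGen d : CycProd d)).comp
    (fun c : Multiplicative (ZMod d) =>
      ⟨c.toAdd.val, (ZMod.val_lt c.toAdd).trans_eq natDegree_eq.symm⟩)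
    fun c c' h => ?_
  exact Multiplicative.toAdd.injective (ZMod.val_injective d (congrArg Fin.val h))

theorem finrank_cycProd (d : ℕ) : Module.finrank ℚ (CycProd d) = d := by
  rw [Module.finrank_pi_fintype]
  simp only [finrank_Ecyc (NeZero.ne _)]
  rw [Finset.sum_coe_sort d.divisors (fun e => e.totient), Nat.sum_totient]

/-- The basis of the product of the cyclotomic fields indexed by `ℤ/d`, with `c ↦ (ω_e ^ c)_e`. -/
def cycBasis (d : ℕ) [NeZero d] : Module.Basis (Multiplicative (ZMod d)) ℚ (CycProd d) :=
  basisOfLinearIndependentOfCardEqFinrank (linearIndependent_cycGen_pow d) <| by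
    rw [finrank_cycProd, Fintype.card_multiplicative, ZMod.card]

end CyclotomicProduct

section Params

variable {n : ℕ} (k : Fin (n + 1) → ℕ)

/-- The character `c ↦ (ω_e ^ c)_e` of `ℤ/d`. -/
def cycChar (d : ℕ) [NeZero d] : Multiplicative (ZMod d) →* (CycProd d)ˣ where
  toFun c := cycGen d ^ c.toAdd.val
  map_one' := by simp
  map_mul' c c' := by
    rw [toAdd_mul, ZMod.val_add, ← pow_eq_pow_mod _ (cycGen_pow_self d), pow_add]

theorem coe_cycChar {d : ℕ} [NeZero d] (c : Multiplicative (ZMod d)) :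
    (cycChar d c : CycProd d) = cycBasis d c := by
  simp [cycBasis, cycChar]

/-- The homomorphism `F_{n+1} → ℤ/d`, `x_i ↦ k_i`, whose kernel is `K_0(k,d)`. -/
abbrev degreeHom (d : ℕ) : FreeGroup (Fin (n + 1)) →* Multiplicative (ZMod d) :=
  FreeGroup.lift fun i => .ofAdd (k i : ZMod d)

/-- The parameters `(ω_e ^ k_i)_e` in the product of the cyclotomic fields. -/
abbrev cycParams (d : ℕ) : Fin (n + 1) → (CycProd d)ˣ :=
  piParams fun e : d.divisors => params k e

theorem cycBasis_degreeHom {d : ℕ} [NeZero d] (g : FreeGroup (Fin (n + 1))) :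
    cycBasis d (degreeHom k d g) = (FreeGroup.lift (cycParams k d) g : CycProd d) := by
  suffices h : (cycChar d).comp (degreeHom k d) = FreeGroup.lift (cycParams k d) by
    rw [← coe_cycChar, ← h, MonoidHom.comp_apply]
  ext1 i
  have cycChar_natCast (m : ℕ) : cycChar d (.ofAdd (m : ZMod d)) = cycGen d ^ m := by
    change cycGen d ^ (m : ZMod d).val = _
    rw [ZMod.val_natCast, ← pow_eq_pow_mod _ (cycGen_pow_self d)]
  rw [MonoidHom.comp_apply, FreeGroup.lift_apply_of, FreeGroup.lift_apply_of, cycChar_natCast]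
  ext e
  rw [cycGen_pow_apply, piParams_apply, params]

variable {k}

theorem degreeHom_surjective {d : ℕ} [NeZero d] {i : Fin (n + 1)} (h : (k i).Coprime d) :
    Function.Surjective (degreeHom k d) := by
  intro c
  let m := (c.toAdd * ((ZMod.unitOfCoprime (k i) h)⁻¹ : (ZMod d)ˣ)).val
  refine ⟨.of i ^ m, Multiplicative.toAdd.injective ?_⟩
  rw [map_pow, FreeGroup.lift_apply_of, toAdd_pow, toAdd_ofAdd, nsmul_eq_mul, ZMod.natCast_val,
    ZMod.cast_id', id, ← ZMod.coe_unitOfCoprime (k i) h, Units.inv_mul_cancel_right]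

theorem params_ne_one {d e : ℕ} (hed : e ∣ d) (he : 2 ≤ e) {i : Fin (n + 1)}
    (h : (k i).Coprime d) : params k e i ≠ 1 := by
  rw [params, Ne, (isPrimitiveRoot_omega (by omega)).pow_eq_one_iff_dvd]
  intro hek
  have e_eq_one : e = 1 := Nat.eq_one_of_dvd_coprimes h hek hed
  omega

theorem params_one (i : Fin (n + 1)) : params k 1 i = 1 := by
  rw [params, IsPrimitiveRoot.one_right_iff.1 (isPrimitiveRoot_omega one_ne_zero), one_pow]

theorem prod_params (e : ℕ) : ∏ i, params k e i = omega e ^ ∑ i, k i :=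
  Finset.prod_pow_eq_pow_sum _ _ _

theorem prod_params_eq_one_iff {e : ℕ} (he : e ≠ 0) : ∏ i, params k e i = 1 ↔ e ∣ ∑ i, k i := by
  rw [prod_params, (isPrimitiveRoot_omega he).pow_eq_one_iff_dvd]

theorem K0_le_ker_lift_params {d e : ℕ} [NeZero d] (hed : e ∣ d) :
    K0 k d ≤ (FreeGroup.lift (params k e)).ker := fun g hg => by
  have lift_eq_one := MonoidHom.mem_ker.1 (ker_le_ker_lift (cycBasis_degreeHom k) hg)
  refine Units.ext ((lift_piParams_apply (fun e : d.divisors => params k e)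
    ⟨e, Nat.mem_divisors.2 ⟨hed, NeZero.ne d⟩⟩ g).symm.trans ?_)
  rw [lift_eq_one]
  rfl

end Params

section Homology

variable {n d : ℕ} [NeZero d] {k : Fin (n + 1) → ℕ}

theorem span_vectorPart_N0 {e : ℕ} (hed : e ∣ d) :
    Submodule.span (Ecyc e) (vectorPart (params k e) '' N0 k d) =
      Submodule.span (Ecyc e) (vectorPart (params k e) '' punctureLoops k d) :=
  span_vectorPart_normalClosure fun _ hg =>
    K0_le_ker_lift_params hed (N0_le_K0 k d (Subgroup.subset_normalClosure hg))

theorem span_vectorPart_N0_submoduleOf_eq_invariants {e : ℕ} (hkd : ∀ i, (k i).Coprime d)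
    (hed : e ∣ d) (he : 2 ≤ e) :
    (Submodule.span (Ecyc e) (vectorPart (params k e) '' N0 k d)).submoduleOf
      (reducedSpace (params k e)) = (gRed k e).invariants := by
  have lift_eq_one {g : FreeGroup (Fin (n + 1))} (hg : g ∈ punctureLoops k d) :
      FreeGroup.lift (params k e) g = 1 :=
    K0_le_ker_lift_params hed (N0_le_K0 k d (Subgroup.subset_normalClosure hg))
  have exponent_pos : 0 < d / Nat.gcd (∑ i, k i) d :=
    Nat.div_pos (Nat.gcd_le_right _ (NeZero.pos d)) (Nat.gcd_pos_of_pos_right _ (NeZero.pos d))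
  rw [span_vectorPart_N0 hed]
  refine span_vectorPart_submoduleOf_eq_invariants
    (fun i => params_ne_one hed he (hkd i)) (fun i => ?_) ?_
    (Nat.cast_ne_zero.2 exponent_pos.ne')
  · simpa using lift_eq_one (Set.mem_insert_of_mem _ ⟨i, rfl⟩)
  · simpa [lift_loopAtInfinity] using lift_eq_one (Set.mem_insert _ _)

theorem span_vectorPart_N0_eq_top :
    Submodule.span (Ecyc 1) (vectorPart (params k 1) '' N0 k d) = ⊤ := by
  rw [span_vectorPart_N0 (one_dvd d), ← top_le_iff,
    ← span_vectorPart_of_pow_eq_top params_one (Nat.cast_ne_zero.2 (NeZero.ne d))]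
  exact Submodule.span_mono (Set.image_mono (Set.subset_insert _ _))

/-- A divisor of `d` other than `1`, as a divisor of `d`. -/
def toDivisor (e : {e : ℕ // e ∣ d ∧ 2 ≤ e}) : d.divisors :=
  ⟨e.1, Nat.mem_divisors.2 ⟨e.2.1, NeZero.ne d⟩⟩

/-- The map which sends a vector in the reduced space over the product of the cyclotomic fields to
the classes of its components at the divisors `e ≥ 2` of `d`, modulo the invariants. -/
def componentClasses (k : Fin (n + 1) → ℕ) (d : ℕ) [NeZero d] :
    reducedSpace (cycParams k d) →ₗ[ℚ]
      ∀ e : {e : ℕ // e ∣ d ∧ 2 ≤ e}, Wspace k e.1 ⧸ (gRed k e.1).invariants where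
  toFun v e := Submodule.Quotient.mk
    ⟨piComponent (toDivisor e) v.1, piComponent_mem_reducedSpace _ (toDivisor e) v.2⟩
  map_add' _ _ := rfl
  map_smul' _ _ := rfl

theorem ker_componentClasses (hkd : ∀ i, (k i).Coprime d) :
    LinearMap.ker (componentClasses k d) = relationSpace ℚ (cycParams k d) (N0 k d) := by
  ext v
  have mem_relationSpace : v ∈ relationSpace ℚ (cycParams k d) (N0 k d) ↔ ∀ e : d.divisors,
      piComponent e v.1 ∈ Submodule.span (Ecyc e) (vectorPart (params k e) '' N0 k d) :=
    mem_span_vectorPart_piParams _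
  have mem_invariants (e : d.divisors) (he : 2 ≤ e.1) :
      (⟨piComponent e v.1, piComponent_mem_reducedSpace _ e v.2⟩ : Wspace k e) ∈
        (gRed k e).invariants ↔
      piComponent e v.1 ∈ Submodule.span (Ecyc e) (vectorPart (params k e) '' N0 k d) := by
    rw [← span_vectorPart_N0_submoduleOf_eq_invariants hkd (Nat.dvd_of_mem_divisors e.2) he]
    rfl
  rw [mem_relationSpace, LinearMap.mem_ker, funext_iff]
  refine ⟨fun h e => ?_, fun h e => (Submodule.Quotient.mk_eq_zero _).2
    ((mem_invariants (toDivisor e) e.2.2).2 (h _))⟩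
  obtain ⟨e, he_mem⟩ := e
  obtain rfl | he : e = 1 ∨ 2 ≤ e := by
    have := Nat.pos_of_mem_divisors he_mem
    omega
  · rw [span_vectorPart_N0_eq_top]
    exact Submodule.mem_top
  · exact (mem_invariants _ he).1 <| (Submodule.Quotient.mk_eq_zero _).1 <|
      h ⟨e, Nat.dvd_of_mem_divisors he_mem, he⟩

theorem componentClasses_surjective : Function.Surjective (componentClasses k d) := by
  intro y
  choose w hw using fun e => Submodule.Quotient.mk_surjective _ (y e)
  let v (e : d.divisors) : Wspace k e :=
    if he : 2 ≤ e.1 then w ⟨e.1, Nat.dvd_of_mem_divisors e.2, he⟩ else 0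
  refine ⟨⟨fun j e => (v e).1 j, (mem_reducedSpace_piParams _).2 fun e => (v e).2⟩,
    funext fun e => (congrArg Submodule.Quotient.mk ?_).trans (hw e)⟩
  exact dif_pos e.2.2

/-- The linear isomorphism from `X_0 = H_1(Q_0(k,d), ℚ)` to the product, over the divisors `e ≥ 2`
of `d`, of the quotients of `g_n(k,e)` by their invariants. -/
def homologyEquiv (hkd : ∀ i, (k i).Coprime d) : H1Q (Q0 k d) ≃ₗ[ℚ]
    ∀ e : {e : ℕ // e ∣ d ∧ 2 ≤ e}, Wspace k e.1 ⧸ (gRed k e.1).invariants :=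
  (h1Equiv (degreeHom_surjective (hkd 0)) (cycBasis_degreeHom k) (N0_le_K0 k d)).trans <|
    (Submodule.quotEquivOfEq _ _ (ker_componentClasses hkd).symm).trans <|
      (componentClasses k d).quotKerEquivOfSurjective componentClasses_surjective

theorem homologyEquiv_of (hkd : ∀ i, (k i).Coprime d) (g : K0 k d)
    (e : {e : ℕ // e ∣ d ∧ 2 ≤ e}) :
    homologyEquiv hkd (H1Q.of (QuotientGroup.mk g)).toAdd e =
      Submodule.Quotient.mk (reducedVector (K0_le_ker_lift_params e.2.1) g).toAdd := by
  have h1Equiv_of := h1ToQuotient_of_mk (N := N0 k d) (cycBasis_degreeHom k) g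
  have component : piComponent (toDivisor e) (vectorPart (cycParams k d) g) =
      vectorPart (params k e) g :=
    piComponent_vectorPart (fun e : d.divisors => params k e) (toDivisor e) g
  refine (congrArg (fun x => ((Submodule.quotEquivOfEq _ _ (ker_componentClasses hkd).symm).trans
    ((componentClasses k d).quotKerEquivOfSurjective componentClasses_surjective)) x e)
      h1Equiv_of).trans ?_
  exact congrArg Submodule.Quotient.mk (Subtype.ext component)

theorem homologyEquiv_X0 (hkd : ∀ i, (k i).Coprime d) (b : PureBraidGroup n) (x : H1Q (Q0 k d))
    (e : {e : ℕ // e ∣ d ∧ 2 ≤ e}) :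
    homologyEquiv hkd (X0 k d b x) e = gBar k e b (homologyEquiv hkd x e) := by
  suffices h : LinearMap.proj e ∘ₗ (homologyEquiv hkd).toLinearMap ∘ₗ X0 k d b =
      restrictToRat (gBar k e) b ∘ₗ LinearMap.proj e ∘ₗ (homologyEquiv hkd).toLinearMap from
    DFunLike.congr_fun h x
  refine H1Q.hom_ext fun q => ?_
  obtain ⟨g, rfl⟩ := QuotientGroup.mk_surjective q
  have X0_of : X0 k d b (H1Q.of (QuotientGroup.mk g)).toAdd =
      (H1Q.of (QuotientGroup.mk (artinK0 k d b g))).toAdd :=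
    H1QRep_of (artinQ0 k d b) (QuotientGroup.mk g)
  simp only [LinearMap.comp_apply, X0_of, LinearEquiv.coe_coe, LinearMap.proj_apply,
    homologyEquiv_of, reducedVector_artinK0]
  rfl

instance : Fintype {e : ℕ // e ∣ d ∧ 2 ≤ e} :=
  Fintype.ofInjective toDivisor fun _ _ h =>
    Subtype.ext (congrArg (Subtype.val : d.divisors → ℕ) h)

/-- The isomorphism between `X_0` and the direct sum of the quotients of `g_n(k,e)` by their
invariants, as representations of the pure braid group over `ℚ`. -/
def x0Equiv (hkd : ∀ i, (k i).Coprime d) :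
    (X0 k d).Equiv (Representation.directSum fun e : {e : ℕ // e ∣ d ∧ 2 ≤ e} =>
      restrictToRat (gBar k e.1)) :=
  let ι := DirectSum.linearEquivFunOnFintype ℚ {e : ℕ // e ∣ d ∧ 2 ≤ e}
    fun e => Wspace k e.1 ⧸ (gRed k e.1).invariants
  .mk ((homologyEquiv hkd).trans ι.symm) fun b => by
    refine LinearMap.ext fun x => ι.injective (funext fun e => ?_)
    have ι_directSum (z) : ι (Representation.directSum
        (fun e : {e : ℕ // e ∣ d ∧ 2 ≤ e} => restrictToRat (gBar k e.1)) b z) e =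
          gBar k e.1 b (ι z e) := rfl
    simp only [LinearMap.comp_apply, LinearEquiv.coe_coe, LinearEquiv.trans_apply, ι_directSum,
      LinearEquiv.apply_symm_apply]
    exact homologyEquiv_X0 hkd b x e

end Homology

end

theorem mainTheorem6 (n d : ℕ) (hn : 1 ≤ n) (hd : 2 ≤ d) (k : Fin (n + 1) → ℕ)
    (hk : ∀ i, 1 ≤ k i ∧ k i ≤ d - 1) (hkd : ∀ i, Nat.Coprime (k i) d) :
    Nonempty ((X0 k d).Equiv
      (Representation.directSum fun e : {e : ℕ // e ∣ d ∧ 2 ≤ e} =>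
        restrictToRat (gBar k e.1))) ∧
    ∀ e : ℕ, e ∣ d → 2 ≤ e →
      Module.finrank (Ecyc e) (gRed k e).invariants = if e ∣ ∑ i, k i then 1 else 0 := by
  classical
  have : NeZero d := ⟨by omega⟩
  refine ⟨⟨x0Equiv hkd⟩, fun e hed he => ?_⟩
  have params_ne_one (i : Fin (n + 1)) : params k e i ≠ 1 := params_ne_one hed he (hkd i)
  rw [gRed, finrank_invariants_reducedGassner params_ne_one]
  simp only [prod_params_eq_one_iff (by omega : e ≠ 0)]
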